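/- A partial semigroup is a nonempty set $S$ with an operation $*$ defined on a nonempty subset of $S\times S$ such that for all $x,y,z\in S$, $(x*y)*z=x*(y*z)$ in the sense that if either side is defined then so is the other and they are equal. For a set $X$, let $\mathcal P_f(X)$ be the set of finite nonempty subsets of $X$, and let $\mathbb N=\{1,2,3,\ldots\}$. For $a\in S$ put $\varphi(a)=\{b\in S: a*b \text{ is defined}\}$, and for $F\in\mathcal P_f(S)$ put $\sigma(F)=\bigcap_{a\in F}\varphi(a)$. The partial semigroup $S$ is adequate if $\sigma(F)\neq\emptyset$ for every $F\in\mathcal P_f(S)$. Let $(S,*)$ be an adequate partial semigroup. Let $\beta S$ be the set of ultrafilters on the discrete set $S$, and let $\delta S=\{p\in\beta S: \sigma(F)\in p\text{ for all }F\in\mathcal P_f(S)\}$. With the operation determined by $A\in p*q\iff\{x\in S:\{y\in\varphi(x):x*y\in A\}\in q\}\in p$ (and the topology of $\beta S$), $\delta S$ is a compact Hausdorff right topological semigroup; let $K(\delta S)$ be its smallest two-sided ideal. A set $A\subseteq S$ is piecewise syndetic if there is $p\in K(\delta S)$ with $A\in p$. A sequence $f:\mathbb N\to S$ is adequate if (i)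 for each $H\in\mathcal P_f(\mathbb N)$ the product $\prod_{t\in H}f(t)$, taken in increasing order of indices, is defined, and (ii) for each $F\in\mathcal P_f(S)$ there is $m\in\mathbb N$ such that $\prod_{t\in H}f(t)\in\sigma(F)$ for every $H\in\mathcal P_f(\mathbb N)$ with $\min H\geq m$. Let $\mathcal T$ be the set of adequate sequences in $S$. A set $A\subseteq S$ is a $1$-CR set if for every $L\in\mathcal P_f(S)$ there is $r\in\mathbb N$ such that for every $f\in\mathcal T$ there exist $m\in\mathbb N$, $a\in S^{m+1}$ and $t(1)<\cdots<t(m)\leq r$ in $\mathbb N$ such that the product $$a(1)*f(t(1))*a(2)*\cdots*a(m)*f(t(m))*a(m+1)$$ is defined and belongs to $A\cap\sigma(L)$. Theorem. If $S$ is a $1$-CR set in $S$, then every piecewise syndetic subset $A$ of $S$ is a $1$-CR set in $S$. -/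

import Mathlib

/-- A partial semigroup: `mul x y = none` means that `x * y` is undefined. Equality in `Option`
in `assoc` says that if one side is defined then so is the other and they are equal. The field
`exists_defined` says that `S` and the domain of the operation are nonempty. -/
class PartialSemigroup (S : Type*) where
  mul : S → S → Option S
  exists_defined : ∃ x y z : S, mul x y = some z
  assoc : ∀ x y z : S,
    (mul x y).bind (fun u => mul u z) = (mul y z).bind (fun v => mul x v)

namespace PartialSemigroup

variable {S : Type*} [PartialSemigroup S]

/-- `φ(a)`: the set of `b` for which `a * b` is defined. -/
def phi (a : S) : Set S := {b | ∃ c, mul a b = some c}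

/-- `σ(F) = ⋂ a ∈ F, φ(a)`. -/
def sigma (F : Finset S) : Set S := ⋂ a ∈ F, phi a

variable (S) in
/-- `S` is adequate if `σ(F)` is nonempty for every finite nonempty `F`. -/
def IsAdequate : Prop := ∀ F : Finset S, F.Nonempty → (sigma F).Nonempty

/-- `x⁻¹A = {y ∈ φ(x) : x * y ∈ A}`. -/
def leftQuot (x : S) (A : Set S) : Set S := {y | ∃ z ∈ A, mul x y = some z}

/-! ### The semigroup `δS` -/

variable (S) in
/-- `δS`: the ultrafilters on `S` that contain `σ(F)` for every finite nonempty `F`. -/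
def delta : Set (Ultrafilter S) := {p | ∀ F : Finset S, F.Nonempty → sigma F ∈ p}

theorem phi_mem {p : Ultrafilter S} (hp : p ∈ delta S) (x : S) : phi x ∈ p := by
  simpa [sigma] using hp {x} (Finset.singleton_nonempty x)

theorem leftQuot_mono (x : S) {A B : Set S} (h : A ⊆ B) : leftQuot x A ⊆ leftQuot x B :=
  fun _ ⟨z, hz, e⟩ => ⟨z, h hz, e⟩

theorem leftQuot_inter (x : S) (A B : Set S) :
    leftQuot x (A ∩ B) = leftQuot x A ∩ leftQuot x B := by
  ext y
  constructor
  · rintro ⟨z, hz, e⟩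
    exact ⟨⟨z, hz.1, e⟩, ⟨z, hz.2, e⟩⟩
  · rintro ⟨⟨z, hz, e⟩, ⟨w, hw, e'⟩⟩
    obtain rfl : z = w := Option.some.inj (e.symm.trans e')
    exact ⟨z, ⟨hz, hw⟩, e⟩

theorem leftQuot_univ (x : S) : leftQuot x Set.univ = phi x := by
  ext y; simp [leftQuot, phi]

theorem leftQuot_compl_mem {q : Ultrafilter S} (hq : q ∈ delta S) (x : S) (A : Set S) :
    leftQuot x Aᶜ ∈ q ↔ leftQuot x A ∉ q := by
  rw [← Ultrafilter.compl_mem_iff_notMem]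
  constructor
  · refine fun h => Filter.mem_of_superset h ?_
    rintro y ⟨z, hz, e⟩ ⟨w, hw, e'⟩
    obtain rfl : z = w := Option.some.inj (e.symm.trans e')
    exact hz hw
  · refine fun h => Filter.mem_of_superset (Filter.inter_mem h (phi_mem hq x)) ?_
    rintro y ⟨h1, z, e⟩
    exact ⟨z, fun hz => h1 ⟨z, hz, e⟩, e⟩

/-- The product `p * q`, for `q ∈ δS`: `A ∈ p * q` iff `{x : x⁻¹A ∈ q} ∈ p`. -/
def ultraMul (p q : Ultrafilter S) (hq : q ∈ delta S) : Ultrafilter S :=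
  Ultrafilter.ofComplNotMemIff
    { sets := {A | {x | leftQuot x A ∈ q} ∈ p}
      univ_sets := by
        simp only [Set.mem_ofPred_eq, leftQuot_univ]
        exact Filter.mem_of_superset Filter.univ_mem fun x _ => phi_mem hq x
      sets_of_superset := fun {A B} hA hAB =>
        Filter.mem_of_superset hA fun x hx => Filter.mem_of_superset hx (leftQuot_mono x hAB)
      inter_sets := fun {A B} hA hB => by
        refine Filter.mem_of_superset (Filter.inter_mem hA hB) fun x hx => ?_
        simp only [Set.mem_ofPred_eq, leftQuot_inter]
        exact Filter.inter_mem hx.1 hx.2 }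
    (fun A => by
      change {x | leftQuot x Aᶜ ∈ q} ∉ p ↔ {x | leftQuot x A ∈ q} ∈ p
      rw [← Ultrafilter.compl_mem_iff_notMem]
      have : {x | leftQuot x Aᶜ ∈ q}ᶜ = {x | leftQuot x A ∈ q} := by
        ext x
        simp [leftQuot_compl_mem hq]
      rw [this])

theorem mem_ultraMul {p q : Ultrafilter S} {hq : q ∈ delta S} {A : Set S} :
    A ∈ ultraMul p q hq ↔ {x | leftQuot x A ∈ q} ∈ p := Iff.rfl

theorem leftQuot_leftQuot {x y z : S} (h : mul x y = some z) (A : Set S) :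
    leftQuot y (leftQuot x A) = leftQuot z A := by
  ext w
  have e := assoc x y w
  rw [h, Option.bind_some] at e
  constructor
  · rintro ⟨v, ⟨u, hu, e1⟩, e2⟩
    rw [e2, Option.bind_some] at e
    exact ⟨u, hu, e.trans e1⟩
  · rintro ⟨u, hu, e1⟩
    rw [e1] at e
    obtain ⟨v, e2, e3⟩ := Option.bind_eq_some_iff.1 e.symm
    exact ⟨v, ⟨u, hu, e3⟩, e2⟩

theorem ultraMul_mem_delta {p q : Ultrafilter S} (hp : p ∈ delta S) (hq : q ∈ delta S) :
    ultraMul p q hq ∈ delta S := by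
  intro F _
  refine (Filter.biInter_finset_mem F).2 fun a _ => ?_
  refine mem_ultraMul.2 (Filter.mem_of_superset (phi_mem hp a) ?_)
  rintro x ⟨z, hz⟩
  have : leftQuot x (phi a) = phi z := by
    rw [← leftQuot_univ, leftQuot_leftQuot hz, leftQuot_univ]
  simpa [this] using phi_mem hq z

/-- `δS` is a semigroup. -/
instance : Semigroup (delta S) where
  mul p q := ⟨ultraMul p.1 q.1 q.2, ultraMul_mem_delta p.2 q.2⟩
  mul_assoc p q r := by
    refine Subtype.ext (Ultrafilter.ext fun A => ?_)
    change {x | leftQuot x A ∈ r.1} ∈ ultraMul p.1 q.1 q.2 ↔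
      {x | {y | leftQuot y (leftQuot x A) ∈ r.1} ∈ q.1} ∈ p.1
    rw [mem_ultraMul]
    have : ∀ x, leftQuot x {y | leftQuot y A ∈ r.1} ∈ q.1 ↔
        {y | leftQuot y (leftQuot x A) ∈ r.1} ∈ q.1 := by
      intro x
      refine Filter.congr_sets (Filter.mem_of_superset (phi_mem q.2 x) ?_)
      rintro y ⟨z, hz⟩
      simp only [Set.mem_ofPred_eq, leftQuot_leftQuot hz]
      constructor
      · rintro ⟨w, hw, e⟩
        obtain rfl : z = w := Option.some.inj (hz.symm.trans e)
        exact hw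
      · exact fun h => ⟨z, h, hz⟩
    simp only [this]

/-- A (two sided) ideal of a semigroup: a nonempty `I` with `M * I ⊆ I` and `I * M ⊆ I`. -/
def IsTwoSidedIdeal {M : Type*} [Mul M] (I : Set M) : Prop :=
  I.Nonempty ∧ ∀ x ∈ I, ∀ y : M, y * x ∈ I ∧ x * y ∈ I

/-- `K(M)`, the smallest two sided ideal of `M`, as the intersection of all two sided ideals. -/
def smallestIdeal (M : Type*) [Mul M] : Set M := ⋂₀ {I | IsTwoSidedIdeal I}

/-- `A` is piecewise syndetic if the closure of `A` in `βS` meets `K(δS)`, that is,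
`A` belongs to some ultrafilter in `K(δS)`. -/
def IsPiecewiseSyndetic (A : Set S) : Prop :=
  ∃ p ∈ smallestIdeal (delta S), A ∈ (p : Ultrafilter S)

/-! ### Adequate sequences and `k`-CR sets -/

/-- The product of a nonempty list, in order; `none` if it is not defined. -/
def listProd : List S → Option S
  | [] => none
  | [a] => some a
  | a :: b :: l => (listProd (b :: l)).bind (mul a)

/-- The product of the `f t`, `t ∈ H`, in increasing order of indices. -/
def finsetProd (f : ℕ+ → S) (H : Finset ℕ+) : Option S :=
  listProd ((H.sort (· ≤ ·)).map f)

/-- `FP(⟨f(t)⟩_{t ≥ m})`. -/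
def FP (f : ℕ+ → S) (m : ℕ+) : Set S :=
  {x | ∃ H : Finset ℕ+, H.Nonempty ∧ (∀ t ∈ H, m ≤ t) ∧ finsetProd f H = some x}

/-- Adequate sequences. -/
def IsAdequateSeq (f : ℕ+ → S) : Prop :=
  (∀ H : Finset ℕ+, H.Nonempty → ∃ x, finsetProd f H = some x) ∧
  ∀ F : Finset S, F.Nonempty → ∃ m : ℕ+, FP f m ⊆ sigma F

/-- The word `a(1), f(t(1)), a(2), …, a(m), f(t(m)), a(m+1)`. -/
def altWord (f : ℕ+ → S) {m : ℕ} (a : Fin (m + 1) → S) (t : Fin m → ℕ+) : List S :=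
  (List.ofFn fun i : Fin m => [a i.castSucc, f (t i)]).flatten ++ [a (Fin.last m)]

/-- `A` is a `k`-CR set (for `k ≥ 1`). -/
def IsKCR (k : ℕ) (A : Set S) : Prop :=
  ∀ L : Finset S, L.Nonempty → ∃ r : ℕ+,
    ∀ F : Finset (ℕ+ → S), F.Nonempty → F.card ≤ k → (∀ f ∈ F, IsAdequateSeq f) →
      ∃ m : ℕ, 1 ≤ m ∧ ∃ a : Fin (m + 1) → S, ∃ t : Fin m → ℕ+,
        StrictMono t ∧ (∀ i, t i ≤ r) ∧
        ∀ f ∈ F, ∃ x, listProd (altWord f a t) = some x ∧ x ∈ A ∩ sigma L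

end PartialSemigroup

namespace PartialSemigroup

/-! Let `p` in K(δS) contain A ∩ σ(L). Every q in δS satisfies p = v * (q * p) for some v, so q
contains C = {y : x * (y * z) ∈ A ∩ σ(L) for some x, z}. As C lies in every member of δS,
compactness gives σ(G) ⊆ C for some finite G. The hypothesis on S, applied to G, bounds the indices
of an alternating product y in σ(G). Then x * y * z lies in A ∩ σ(L), and x and z are absorbed into
the outer coefficients, so the indices and their bound do not change. -/

/-- A compact Hausdorff right topological semigroup has a minimal left ideal. -/
theorem exists_minimal_leftIdeal (M : Type*) [Semigroup M] [TopologicalSpace M] [CompactSpace M]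
    [T2Space M] [Nonempty M] (hc : ∀ r : M, Continuous fun x : M => x * r) :
    ∃ N : Set M, N.Nonempty ∧ (∀ x ∈ N, ∀ y, y * x ∈ N) ∧ ∀ x ∈ N, ∀ n ∈ N, ∃ v, v * x = n := by
  let 𝓛 : Set (Set M) := {N | IsClosed N ∧ N.Nonempty ∧ ∀ x ∈ N, ∀ y, y * x ∈ N}
  obtain ⟨N, hN⟩ : ∃ N, Minimal (· ∈ 𝓛) N := by
    refine zorn_superset 𝓛 fun c hc𝓛 hchain => ?_
    rcases c.eq_empty_or_nonempty with rfl | hne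
    · exact ⟨Set.univ, ⟨isClosed_univ, Set.univ_nonempty, fun _ _ _ => trivial⟩, by simp⟩
    refine ⟨⋂₀ c, ⟨isClosed_sInter fun s hs => (hc𝓛 hs).1, ?_, ?_⟩,
      fun s hs => Set.sInter_subset_of_mem hs⟩
    · have := hne.to_subtype
      exact IsCompact.nonempty_sInter_of_directed_nonempty_isCompact_isClosed
        (IsChain.directedOn hchain.symm) (fun s hs => (hc𝓛 hs).2.1)
        (fun s hs => (hc𝓛 hs).1.isCompact) (fun s hs => (hc𝓛 hs).1)
    · exact fun x hx y s hs => (hc𝓛 hs).2.2 x (hx s hs) y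
  refine ⟨N, hN.prop.2.1, hN.prop.2.2, fun x hx n hn => ?_⟩
  have hsub : Set.range (fun v : M => v * x) ⊆ N := by
    rintro _ ⟨v, rfl⟩
    exact hN.prop.2.2 x hx v
  -- The left ideal M * x is a continuous image of a compact space, hence closed, so minimality
  -- among closed left ideals forces M * x = N.
  have hmem : Set.range (fun v : M => v * x) ∈ 𝓛 := by
    refine ⟨(isCompact_range (hc x)).isClosed, Set.range_nonempty _, ?_⟩
    rintro _ ⟨v, rfl⟩ y
    exact ⟨y * v, mul_assoc y v x⟩
  exact hN.le_of_le hmem hsub hn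

/-- For a minimal left ideal N, the set N * M is a two-sided ideal, so p = n * s with n in N. Since
M * (q * n) = N, some v recovers n from q * n; multiply by s on the right. -/
theorem exists_mul_mul_eq_of_mem_smallestIdeal {M : Type*} [Semigroup M] [TopologicalSpace M]
    [CompactSpace M] [T2Space M] (hc : ∀ r : M, Continuous fun x : M => x * r)
    {p : M} (hp : p ∈ smallestIdeal M) (q : M) : ∃ v, v * (q * p) = p := by
  have : Nonempty M := ⟨p⟩
  obtain ⟨N, ⟨n₀, hn₀⟩, hleft, hmin⟩ := exists_minimal_leftIdeal M hc
  have hideal : IsTwoSidedIdeal {u : M | ∃ n ∈ N, ∃ s, n * s = u} := by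
    refine ⟨⟨n₀ * n₀, n₀, hn₀, n₀, rfl⟩, ?_⟩
    rintro _ ⟨n, hn, s, rfl⟩ y
    exact ⟨⟨y * n, hleft n hn y, s, mul_assoc y n s⟩, ⟨n, hn, s * y, (mul_assoc n s y).symm⟩⟩
  obtain ⟨n, hn, s, rfl⟩ := hp _ hideal
  obtain ⟨v, hv⟩ := hmin (q * n) (hleft n hn q) n hn
  exact ⟨v, by rw [← mul_assoc q n s, ← mul_assoc, hv]⟩

variable {S : Type*} [PartialSemigroup S]

theorem isClosed_delta : IsClosed (delta S) := by
  have : delta S = ⋂ (F : Finset S) (_ : F.Nonempty), {p : Ultrafilter S | sigma F ∈ p} := by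
    ext p
    simp [delta]
  rw [this]
  exact isClosed_iInter fun F => isClosed_iInter fun _ => ultrafilter_isClosed_basic _

instance : CompactSpace (delta S) := isCompact_iff_compactSpace.1 isClosed_delta.isCompact

theorem continuous_delta_mul_right (q : delta S) : Continuous fun p : delta S => p * q := by
  refine Continuous.subtype_mk (continuous_generateFrom_iff.2 ?_)
    fun p => ultraMul_mem_delta p.2 q.2
  rintro _ ⟨A, rfl⟩
  exact (ultrafilter_isOpen_basic {x | leftQuot x A ∈ q.1}).preimage continuous_subtype_val

theorem sigma_anti {F G : Finset S} (h : F ⊆ G) : sigma G ⊆ sigma F :=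
  Set.biInter_subset_biInter_left h

/-- A set that belongs to every member of `δS` contains some `σ(F)`. -/
theorem exists_sigma_subset {C : Set S} (hC : ∀ q ∈ delta S, C ∈ q) :
    ∃ F : Finset S, F.Nonempty ∧ sigma F ⊆ C := by
  by_contra! h
  obtain ⟨s, -⟩ := exists_defined (S := S)
  have h' : ∀ F : Finset S, ∃ x, F.Nonempty → x ∈ sigma F ∧ x ∉ C := by
    intro F
    by_cases hF : F.Nonempty
    · obtain ⟨x, hx⟩ := Set.not_subset.1 (h F hF)
      exact ⟨x, fun _ => hx⟩
    · exact ⟨s, fun h => (hF h).elim⟩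
  choose g hg using h'
  -- Pushing an ultrafilter finer than `atTop` forward along the counterexamples `g F` in σ(F) \ C
  -- gives a member of δS that omits C.
  let u : Ultrafilter (Finset S) := Ultrafilter.of Filter.atTop
  have hu : ∀ F : Finset S, Set.Ici F ∈ u := fun F =>
    Ultrafilter.of_le _ (Filter.mem_atTop F)
  have hδ : u.map g ∈ delta S := by
    intro F hF
    refine Ultrafilter.mem_map.2 (Filter.mem_of_superset (hu F) fun G hG => ?_)
    exact sigma_anti hG (hg G (hF.mono hG)).1
  have hmem : g ⁻¹' C ∈ u := hC _ hδ
  obtain ⟨G, hGC, hG⟩ := u.nonempty_of_mem (Filter.inter_mem hmem (hu {s}))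
  exact (hg G ((Finset.singleton_nonempty s).mono hG)).2 hGC

/-- If `A` is piecewise syndetic, then every `y` in a suitable `σ(F)` satisfies `x * (y * z) ∈ A`
for some `x` and `z`. -/
theorem IsPiecewiseSyndetic.exists_sigma_subset {A : Set S} (hA : IsPiecewiseSyndetic A) :
    ∃ F : Finset S, F.Nonempty ∧
      sigma F ⊆ {y | ∃ x z w, mul y z = some w ∧ ∃ u ∈ A, mul x w = some u} := by
  obtain ⟨p, hp, hAp⟩ := hA
  refine PartialSemigroup.exists_sigma_subset fun q hq => ?_
  obtain ⟨v, hv⟩ :=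
    exists_mul_mul_eq_of_mem_smallestIdeal continuous_delta_mul_right hp ⟨q, hq⟩
  -- Membership in v * (q * p) unfolds to: for v-many x, q-many y and p-many z, x * (y * z) is in A.
  -- One x is fixed.
  rw [← hv] at hAp
  obtain ⟨x, hx⟩ := v.1.nonempty_of_mem (mem_ultraMul (hq := Subtype.prop _).1 hAp)
  refine Filter.mem_of_superset (mem_ultraMul (hq := p.2).1 hx) fun y hy => ?_
  obtain ⟨z, w, ⟨u, hu, hxw⟩, hyz⟩ := p.1.nonempty_of_mem hy
  exact ⟨x, z, w, hyz, u, hu, hxw⟩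

theorem IsPiecewiseSyndetic.inter_sigma {A : Set S} (hA : IsPiecewiseSyndetic A) {L : Finset S}
    (hL : L.Nonempty) : IsPiecewiseSyndetic (A ∩ sigma L) := by
  obtain ⟨p, hp, hAp⟩ := hA
  exact ⟨p, hp, Filter.inter_mem hAp (p.2 L hL)⟩

theorem listProd_cons {l : List S} (hl : l ≠ []) (a : S) :
    listProd (a :: l) = (listProd l).bind (mul a) := by
  cases l with
  | nil => exact (hl rfl).elim
  | cons b l => rfl

theorem exists_mul_of_mul_mul {x a b w u : S} (h : mul a b = some w) (h' : mul x w = some u) :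
    ∃ c, mul x a = some c ∧ mul c b = some u := by
  have e := assoc x a b
  rw [h, Option.bind_some, h'] at e
  exact Option.bind_eq_some_iff.1 e

theorem exists_listProd_cons_mul {l : List S} (hl : l ≠ []) {a w x u : S}
    (h : listProd (a :: l) = some w) (h' : mul x w = some u) :
    ∃ c, listProd (c :: l) = some u := by
  rw [listProd_cons hl] at h
  obtain ⟨b, hb, hab⟩ := Option.bind_eq_some_iff.1 h
  obtain ⟨c, -, hc⟩ := exists_mul_of_mul_mul hab h'
  exact ⟨c, by rw [listProd_cons hl, hb, Option.bind_some, hc]⟩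

/-- The new last factor is b * z: associativity moves z inward past each factor, and carries
definedness with it. -/
theorem exists_listProd_append_mul {l : List S} {b y z w : S}
    (h : listProd (l ++ [b]) = some y) (h' : mul y z = some w) :
    ∃ c, listProd (l ++ [c]) = some w := by
  suffices H : ∃ c, mul b z = some c ∧ listProd (l ++ [c]) = some w from
    H.imp fun _ => And.right
  induction l generalizing y w with
  | nil =>
    obtain rfl : b = y := Option.some.inj h
    exact ⟨w, h', rfl⟩
  | cons a l ih =>
    rw [List.cons_append, listProd_cons (by simp)] at h
    obtain ⟨v, hv, hav⟩ := Option.bind_eq_some_iff.1 h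
    have e := assoc a v z
    rw [hav, Option.bind_some, h'] at e
    obtain ⟨t, ht, hat⟩ := Option.bind_eq_some_iff.1 e.symm
    obtain ⟨c, hc, hl⟩ := ih hv ht
    exact ⟨c, hc, by rw [List.cons_append, listProd_cons (by simp), hl, Option.bind_some, hat]⟩

/-- Multiplying an alternating product on both sides gives an alternating product along the same
indices: the outer factors are absorbed by the first and the last coefficient. -/
theorem exists_altWord_mul_mul (f : ℕ+ → S) {m : ℕ} (hm : 1 ≤ m) (a : Fin (m + 1) → S)
    (t : Fin m → ℕ+) {x y z w u : S} (hy : listProd (altWord f a t) = some y)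
    (hw : mul y z = some w) (hu : mul x w = some u) :
    ∃ a' : Fin (m + 1) → S, listProd (altWord f a' t) = some u := by
  -- With m ≥ 1 the first and last coefficients are distinct entries and can be replaced
  -- independently.
  obtain ⟨n, rfl⟩ : ∃ n, m = n + 1 := ⟨m - 1, by omega⟩
  let mid : List S := (List.ofFn fun i : Fin n => [a i.castSucc.succ, f (t i.succ)]).flatten
  have key : ∀ b c : S, altWord f (Fin.cons b (Fin.snoc (fun i => a i.castSucc.succ) c)) t =
      b :: (f (t 0) :: mid ++ [c]) := by
    intro b c
    simp [altWord, mid, List.ofFn_succ, ← Fin.succ_last]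
  have ha : a = Fin.cons (a 0) (Fin.snoc (fun i => a i.castSucc.succ) (a (Fin.last _))) := by
    refine funext fun i => Fin.cases rfl (fun j => ?_) i
    refine Fin.lastCases ?_ (fun k => ?_) j
    · simp
    · simp
  rw [ha, key, ← List.cons_append] at hy
  obtain ⟨c, hc⟩ := exists_listProd_append_mul hy hw
  obtain ⟨b, hb⟩ := exists_listProd_cons_mul (by simp) hc hu
  exact ⟨_, (congrArg listProd (key b c)).trans hb⟩

end PartialSemigroup

theorem theorem3p7 {S : Type*} [PartialSemigroup S] (hS : PartialSemigroup.IsAdequate S)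
    (hCR : PartialSemigroup.IsKCR 1 (Set.univ : Set S))
    (A : Set S) (hA : PartialSemigroup.IsPiecewiseSyndetic A) :
    PartialSemigroup.IsKCR 1 A := by
  intro L hL
  obtain ⟨G, hG, hGC⟩ := (hA.inter_sigma hL).exists_sigma_subset
  -- G depends only on A and L, so r is fixed before the sequence is given.
  obtain ⟨r, hr⟩ := hCR G hG
  refine ⟨r, fun F hF hcard hadeq => ?_⟩
  obtain ⟨f, rfl⟩ := Finset.card_eq_one.1 (le_antisymm hcard hF.card_pos)
  obtain ⟨m, hm, a, t, ht, htr, hprod⟩ := hr {f} hF hcard hadeq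
  obtain ⟨y, hy, -, hyG⟩ := hprod f (Finset.mem_singleton_self f)
  -- Here x and z depend on y, hence on f. With several sequences the new coefficients could differ
  -- from one to another; with k = 1 there is only one.
  obtain ⟨x, z, w, hw, u, huA, hu⟩ := hGC hyG
  obtain ⟨a', ha'⟩ := PartialSemigroup.exists_altWord_mul_mul f hm a t hy hw hu
  refine ⟨m, hm, a', t, ht, htr, fun g hg => ?_⟩
  obtain rfl := Finset.mem_singleton.1 hg
  exact ⟨u, ha', huA⟩
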